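/- Let $\mathcal M$ be an $(N|N)$-dimensional smooth supermanifold with a nondegenerate antibracket $(\cdot,\cdot)$, that is, an odd bilinear operation on functions with $(F,G)=-(-1)^{(\varepsilon_F+1)(\varepsilon_G+1)}(G,F)$, $(F,GH)=(F,G)H+(-1)^{\varepsilon_G(\varepsilon_F+1)}G(F,H)$ and $\sum_{\mathrm{cycl}(F,G,H)}(-1)^{(\varepsilon_F+1)(\varepsilon_H+1)}(F,(G,H))=0$, whose matrix $(\Gamma^A,\Gamma^B)$ in local coordinates $\Gamma^A$ is invertible; here $\varepsilon$ denotes parity. Let $S$ be an even function on $\mathcal M$ (the master action) with $(S,S)=0$, and put $Q=(S,\cdot)$. Let $Z_Q$ be the zero locus of $Q$ (the stationary surface of $S$), given by the equations $Q^A=0$ where $Q=Q^A\partial_A$, and let $I_{Z_Q}$ be the ideal of functions vanishing on $Z_Q$; it is locally generated by the functions $QF$, and the functions on $Z_Q$ are the functions on $\mathcal M$ modulo $I_{Z_Q}$. Assume that $(\mathcal M,(\cdot,\cdot),Q)$ is a P-QP-manifold: $Q$ is an odd vector field with $Q^2=0$ that differentiates the antibracket, $Z_Q$ is a submanifold, and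 at every point of $Z_Q$ the local cohomology of $Q$ consists of constants only. The formula $\{F,G\}=(F,QG)$ defines the Poisson bracket on the functions on $Z_Q$. A (homogeneous) vector field $X_0$ on $\mathcal M$ preserves the antibracket if $X_0(F,G)=(X_0F,G)+(-1)^{(\varepsilon_F+1)\varepsilon_{X_0}}(F,X_0G)$ for all functions $F,G$; it is a classical gauge symmetry if moreover $X_0S=0$. **Theorem.** Every classical gauge symmetry $X_0$ is a symmetry of the P-QP-manifold $\mathcal M$, that is, it preserves the antibracket and $[Q,X_0]=0$. It restricts to $Z_Q$: there is a unique vector field $x=X_0|_{Z_Q}$ on $Z_Q$ with $x(F|_{Z_Q})=(X_0F)|_{Z_Q}$ for all functions $F$. This restriction preserves the Poisson bracket: $$x\{f,g\}=\{xf,g\}+(-1)^{\varepsilon_f\varepsilon_{X_0}}\{f,xg\}$$ for all functions $f,g$ on $Z_Q$ ($f$ homogeneous). -/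

import Mathlib

open TopologicalSpace Set
open scoped Manifold ContDiff

noncomputable section

universe u v

namespace BV

/-- The sign `(-1)^i` of a parity `i`. -/
def sgn (i : ZMod 2) : ℝ := if i = 0 then 1 else -1

/-- A presheaf on `X` of real algebras with an even part `grading U 0` and an odd part
`grading U 1`. -/
structure SuperPresheaf (X : Type u) [TopologicalSpace X] where
  obj : Opens X → Type v
  [ring : ∀ U, Ring (obj U)]
  [algebra : ∀ U, Algebra ℝ (obj U)]
  grading : ∀ U, ZMod 2 → Submodule ℝ (obj U)
  res : ∀ {U V : Opens X}, V ≤ U → obj U →ₐ[ℝ] obj V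
  res_id : ∀ (U : Opens X) (f : obj U), res le_rfl f = f
  res_res : ∀ {U V W : Opens X} (h : V ≤ U) (k : W ≤ V) (f : obj U),
    res k (res h f) = res (k.trans h) f
  res_mem : ∀ {U V : Opens X} (h : V ≤ U) (i : ZMod 2) (f : obj U),
    f ∈ grading U i → res h f ∈ grading V i

attribute [instance] SuperPresheaf.ring SuperPresheaf.algebra

/-! ### The local model: smooth functions on an open subset of `ℝ^p` with values in the Grassmann
algebra on `q` generators -/

/-- The Grassmann algebra on `q` generators. -/
abbrev Grassmann (q : ℕ) : Type := ExteriorAlgebra ℝ (Fin q → ℝ)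

/-- The even and odd parts of the Grassmann algebra. -/
def grassmannGrading (q : ℕ) (i : ZMod 2) : Submodule ℝ (Grassmann q) :=
  CliffordAlgebra.evenOdd (0 : QuadraticForm ℝ (Fin q → ℝ)) i

/-- A function with values in the Grassmann algebra is smooth if all its components are. -/
def IsSmoothSuper {p q : ℕ} {W : Opens (EuclideanSpace ℝ (Fin p))} (f : W → Grassmann q) : Prop :=
  ∀ l : Grassmann q →ₗ[ℝ] ℝ,
    ContMDiff 𝓘(ℝ, EuclideanSpace ℝ (Fin p)) 𝓘(ℝ, ℝ) ∞ (fun y => l (f y))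

lemma IsSmoothSuper.mul {p q : ℕ} {W : Opens (EuclideanSpace ℝ (Fin p))} {f g : W → Grassmann q}
    (hf : IsSmoothSuper f) (hg : IsSmoothSuper g) : IsSmoothSuper (f * g) := by
  intro l
  let b := (Pi.basisFun ℝ (Fin q)).ExteriorAlgebra
  have key : (fun y => l ((f * g) y)) =
      fun y => ∑ s, ∑ t, b.coord s (f y) * (b.coord t (g y) * l (b s * b t)) := by
    funext y
    have h1 : (f * g) y = (∑ s, b.repr (f y) s • b s) * (∑ t, b.repr (g y) t • b t) := by
      rw [b.sum_repr, b.sum_repr]; rfl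
    rw [h1, Finset.sum_mul_sum, map_sum]
    refine Finset.sum_congr rfl fun s _ => ?_
    rw [map_sum]
    refine Finset.sum_congr rfl fun t _ => ?_
    simp
    ring
  rw [key]
  refine contMDiff_finsetSum fun s _ => contMDiff_finsetSum fun t _ => ?_
  exact (hf _).mul ((hg _).mul contMDiff_const)

/-- The superalgebra `C^∞(W) ⊗ Λ(θ^1, …, θ^q)` of an open set `W ⊆ ℝ^p`. -/
def superFunctions {p : ℕ} (q : ℕ) (W : Opens (EuclideanSpace ℝ (Fin p))) :
    Subalgebra ℝ (W → Grassmann q) where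
  carrier := {f | IsSmoothSuper f}
  mul_mem' hf hg := IsSmoothSuper.mul hf hg
  add_mem' := by
    intro f g hf hg l
    have h : (fun y => l ((f + g) y)) = (fun y => l (f y)) + fun y => l (g y) := by
      funext y
      simp
    rw [h]
    exact (hf l).add (hg l)
  algebraMap_mem' := by
    intro r l
    exact contMDiff_const (c := l (algebraMap ℝ (Grassmann q) r))

/-- The coordinate functions of the local model: `x^1, …, x^p` and `θ^1, …, θ^q`. -/
def modelCoord {p q : ℕ} (W : Opens (EuclideanSpace ℝ (Fin p))) :
    Fin p ⊕ Fin q → superFunctions q W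
  | Sum.inl i => ⟨fun y => algebraMap ℝ (Grassmann q) (y.1 i), by
      intro l
      have h : (fun y : W => l (algebraMap ℝ (Grassmann q) (y.1 i))) =
          fun y : W => (EuclideanSpace.proj i : EuclideanSpace ℝ (Fin p) →L[ℝ] ℝ) y.1 * l 1 := by
        funext y
        rw [Algebra.algebraMap_eq_smul_one, map_smul]
        rfl
      rw [h]
      refine ContMDiff.mul ?_ contMDiff_const
      exact (EuclideanSpace.proj i : EuclideanSpace ℝ (Fin p) →L[ℝ] ℝ).contMDiff.comp
        contMDiff_subtype_val⟩
  | Sum.inr j => ⟨fun _ => ExteriorAlgebra.ι ℝ (Pi.single j 1), fun _ => contMDiff_const⟩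

/-- A coordinate chart: a homeomorphism from an open subset of `X` onto an open subset of `ℝ^p`,
covered by an isomorphism of sheaves of superalgebras with the local model. -/
structure SuperChart {X : Type u} [TopologicalSpace X] (O : SuperPresheaf.{u, v} X)
    (p q : ℕ) where
  toHomeo : OpenPartialHomeomorph X (EuclideanSpace ℝ (Fin p))
  iso : ∀ V : Opens X, (V : Set X) ⊆ toHomeo.source → (O.obj V ≃ₐ[ℝ] superFunctions q
    (⟨toHomeo.target ∩ toHomeo.symm ⁻¹' V, toHomeo.symm.isOpen_inter_preimage V.2⟩ :
      Opens (EuclideanSpace ℝ (Fin p))))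
  mem_grading_iff : ∀ (V : Opens X) (hV : (V : Set X) ⊆ toHomeo.source) (i : ZMod 2)
    (f : O.obj V), f ∈ O.grading V i ↔ ∀ y, (iso V hV f).1 y ∈ grassmannGrading q i
  iso_res : ∀ (V W : Opens X) (hV : (V : Set X) ⊆ toHomeo.source) (h : W ≤ V) (f : O.obj V)
    (y : EuclideanSpace ℝ (Fin p)) (hy : y ∈ toHomeo.target ∩ toHomeo.symm ⁻¹' W),
    (iso W (subset_trans h hV) (O.res h f)).1 ⟨y, hy⟩ = (iso V hV f).1 ⟨y, hy.1, h hy.2⟩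

namespace SuperChart

variable {X : Type u} [TopologicalSpace X] {O : SuperPresheaf.{u, v} X} {p q : ℕ}

/-- The domain of a chart. -/
def domain (c : SuperChart O p q) : Opens X := ⟨c.toHomeo.source, c.toHomeo.open_source⟩

/-- The local coordinates `Γ^A` of a chart (`p` even and `q` odd ones). -/
def coord (c : SuperChart O p q) (a : Fin p ⊕ Fin q) : O.obj c.domain :=
  (c.iso c.domain subset_rfl).symm (modelCoord _ a)

end SuperChart

/-- A smooth supermanifold of dimension `(p|q)` with underlying space `X`: a sheaf of
supercommutative real superalgebras that is locally isomorphic to the local model. -/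
structure Supermanifold (X : Type u) [TopologicalSpace X] [T2Space X] [SecondCountableTopology X]
    (p q : ℕ) extends SuperPresheaf.{u, v} X where
  gradedMonoid : ∀ U, SetLike.GradedMonoid (grading U)
  isInternal : ∀ U, DirectSum.IsInternal (grading U)
  supercomm : ∀ (U : Opens X) (i j : ZMod 2) (f g : obj U), f ∈ grading U i → g ∈ grading U j →
    f * g = sgn (i * j) • (g * f)
  isSheaf : ∀ (ι : Type u) (U : ι → Opens X) (s : ∀ a, obj (U a)),
    (∀ a b, res (inf_le_left : U a ⊓ U b ≤ U a) (s a) =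
      res (inf_le_right : U a ⊓ U b ≤ U b) (s b)) →
    ∃! t : obj (iSup U), ∀ a, res (le_iSup U a) t = s a
  exists_chart : ∀ x : X, ∃ c : SuperChart toSuperPresheaf p q, x ∈ c.domain

section Presheaf

variable {X : Type u} [TopologicalSpace X]

/-- A homogeneous vector field of parity `ε`: a superderivation of the functions. -/
@[ext]
structure VectorField (O : SuperPresheaf.{u, v} X) (ε : ZMod 2) where
  app : ∀ U, O.obj U →ₗ[ℝ] O.obj U
  app_res : ∀ {U V : Opens X} (h : V ≤ U) (f : O.obj U), app V (O.res h f) = O.res h (app U f)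
  app_mem : ∀ (U : Opens X) (i : ZMod 2) (f : O.obj U), f ∈ O.grading U i →
    app U f ∈ O.grading U (i + ε)
  leibniz : ∀ (U : Opens X) (i : ZMod 2) (f g : O.obj U), f ∈ O.grading U i →
    app U (f * g) = app U f * g + sgn (ε * i) • (f * app U g)

/-- An antibracket. -/
structure Antibracket (O : SuperPresheaf.{u, v} X) where
  app : ∀ U, O.obj U →ₗ[ℝ] O.obj U →ₗ[ℝ] O.obj U
  app_res : ∀ {U V : Opens X} (h : V ≤ U) (f g : O.obj U),
    app V (O.res h f) (O.res h g) = O.res h (app U f g)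
  app_mem : ∀ (U : Opens X) (i j : ZMod 2) (f g : O.obj U), f ∈ O.grading U i →
    g ∈ O.grading U j → app U f g ∈ O.grading U (i + j + 1)
  antisymm : ∀ (U : Opens X) (i j : ZMod 2) (f g : O.obj U), f ∈ O.grading U i →
    g ∈ O.grading U j → app U f g = -(sgn ((i + 1) * (j + 1)) • app U g f)
  leibniz : ∀ (U : Opens X) (i j : ZMod 2) (f g h : O.obj U), f ∈ O.grading U i →
    g ∈ O.grading U j →
    app U f (g * h) = app U f g * h + sgn (j * (i + 1)) • (g * app U f h)
  jacobi : ∀ (U : Opens X) (i j k : ZMod 2) (f g h : O.obj U), f ∈ O.grading U i →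
    g ∈ O.grading U j → h ∈ O.grading U k →
    sgn ((i + 1) * (k + 1)) • app U f (app U g h) + sgn ((j + 1) * (i + 1)) • app U g (app U h f) +
      sgn ((k + 1) * (j + 1)) • app U h (app U f g) = 0

/-- The antibracket is nondegenerate: the matrix `E^{AB} = (Γ^A, Γ^B)` is invertible in every
chart. -/
def Antibracket.Nondegenerate {O : SuperPresheaf.{u, v} X} (B : Antibracket O) (p q : ℕ) : Prop :=
  ∀ c : SuperChart O p q,
    IsUnit (Matrix.of fun a b : Fin p ⊕ Fin q => B.app c.domain (c.coord a) (c.coord b))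

/-- The vector field `(S, · )` of an even function `S`; it is odd. -/
def Antibracket.hamiltonian {O : SuperPresheaf.{u, v} X} (B : Antibracket O) (S : O.obj ⊤)
    (hS : S ∈ O.grading ⊤ 0) : VectorField O 1 where
  app U := B.app U (O.res le_top S)
  app_res {U V} h f := by
    rw [← B.app_res h, O.res_res]
  app_mem U i f hf := by
    have := B.app_mem U 0 i _ f (O.res_mem le_top 0 S hS) hf
    rwa [zero_add] at this
  leibniz U i f g hf := by
    have := B.leibniz U 0 i _ f g (O.res_mem le_top 0 S hS) hf
    rwa [zero_add, mul_comm i 1] at this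

/-- A vector field preserves the antibracket. -/
def PreservesAntibracket {O : SuperPresheaf.{u, v} X} (B : Antibracket O) {ε : ZMod 2}
    (Y : VectorField O ε) : Prop :=
  ∀ (U : Opens X) (i : ZMod 2) (f g : O.obj U), f ∈ O.grading U i →
    Y.app U (B.app U f g) =
      B.app U (Y.app U f) g + sgn ((i + 1) * ε) • B.app U f (Y.app U g)

/-- The supercommutator `[Q, Y]` with an odd vector field `Q` vanishes. -/
def CommutesWithOdd {O : SuperPresheaf.{u, v} X} (Q : VectorField O 1) {ε : ZMod 2}
    (Y : VectorField O ε) : Prop :=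
  ∀ (U : Opens X) (f : O.obj U), Q.app U (Y.app U f) - sgn ε • Y.app U (Q.app U f) = 0

/-- The two-sided ideal of functions on `V` generated by (the restrictions of) the functions
in `G`. -/
def genIdeal (O : SuperPresheaf.{u, v} X) (G : ∀ V, Set (O.obj V)) (V : Opens X) :
    Ideal (O.obj V) :=
  Ideal.span {f | ∃ (W : Opens X) (h : V ≤ W), ∃ g ∈ G W, ∃ b, f = O.res h g * b}

lemma genIdeal_mul_right (O : SuperPresheaf.{u, v} X) (G : ∀ V, Set (O.obj V)) (V : Opens X)
    (f b : O.obj V) (hf : f ∈ genIdeal O G V) : f * b ∈ genIdeal O G V := by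
  unfold genIdeal at hf ⊢
  induction hf using Submodule.span_induction with
  | mem x hx =>
    obtain ⟨W, h, g, hg, c, rfl⟩ := hx
    exact Ideal.subset_span ⟨W, h, g, hg, c * b, by rw [mul_assoc]⟩
  | zero => rw [zero_mul]; exact Ideal.zero_mem _
  | add x y _ _ hx hy => rw [add_mul]; exact Ideal.add_mem _ hx hy
  | smul a x _ hx => rw [smul_eq_mul, mul_assoc]; exact Ideal.mul_mem_left _ a hx

lemma res_mem_genIdeal (O : SuperPresheaf.{u, v} X) (G : ∀ V, Set (O.obj V)) {U V : Opens X}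
    (h : V ≤ U) (f : O.obj U) (hf : f ∈ genIdeal O G U) : O.res h f ∈ genIdeal O G V := by
  unfold genIdeal at hf ⊢
  induction hf using Submodule.span_induction with
  | mem x hx =>
    obtain ⟨W, k, g, hg, c, rfl⟩ := hx
    exact Ideal.subset_span ⟨W, h.trans k, g, hg, O.res h c, by rw [map_mul, O.res_res]⟩
  | zero => rw [map_zero]; exact Ideal.zero_mem _
  | add x y _ _ hx hy => rw [map_add]; exact Ideal.add_mem _ hx hy
  | smul a x _ hx => rw [smul_eq_mul, map_mul]; exact Ideal.mul_mem_left _ _ hx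

/-- The ideal sheaf generated by the functions in `G`: the functions that lie locally in the
ideal generated by `G`. -/
def idealSheaf (O : SuperPresheaf.{u, v} X) (G : ∀ V, Set (O.obj V)) (U : Opens X) :
    Ideal (O.obj U) where
  carrier := {f | ∀ x ∈ U, ∃ (V : Opens X) (h : V ≤ U), x ∈ V ∧ O.res h f ∈ genIdeal O G V}
  zero_mem' := fun x hx => ⟨U, le_rfl, hx, by rw [map_zero]; exact Ideal.zero_mem _⟩
  add_mem' := by
    intro f g hf hg x hx
    obtain ⟨V, hV, hxV, h1⟩ := hf x hx
    obtain ⟨W, hW, hxW, h2⟩ := hg x hx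
    refine ⟨V ⊓ W, inf_le_left.trans hV, ⟨hxV, hxW⟩, ?_⟩
    rw [map_add]
    refine Ideal.add_mem _ ?_ ?_
    · have := res_mem_genIdeal O G (inf_le_left : V ⊓ W ≤ V) _ h1
      rwa [O.res_res] at this
    · have := res_mem_genIdeal O G (inf_le_right : V ⊓ W ≤ W) _ h2
      rwa [O.res_res] at this
  smul_mem' := by
    intro a f hf x hx
    obtain ⟨V, hV, hxV, h1⟩ := hf x hx
    exact ⟨V, hV, hxV, by rw [smul_eq_mul, map_mul]; exact Ideal.mul_mem_left _ _ h1⟩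

instance idealSheaf_isTwoSided (O : SuperPresheaf.{u, v} X) (G : ∀ V, Set (O.obj V))
    (U : Opens X) : (idealSheaf O G U).IsTwoSided where
  mul_mem_of_left := by
    intro f b hf x hx
    obtain ⟨V, hV, hxV, h1⟩ := hf x hx
    exact ⟨V, hV, hxV, by rw [map_mul]; exact genIdeal_mul_right O G V _ _ h1⟩

lemma res_mem_idealSheaf (O : SuperPresheaf.{u, v} X) (G : ∀ V, Set (O.obj V)) {U V : Opens X}
    (h : V ≤ U) (f : O.obj U) (hf : f ∈ idealSheaf O G U) : O.res h f ∈ idealSheaf O G V := by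
  intro x hx
  obtain ⟨W, hW, hxW, h1⟩ := hf x (h hx)
  refine ⟨V ⊓ W, inf_le_left, ⟨hx, hxW⟩, ?_⟩
  have := res_mem_genIdeal O G (inf_le_right : V ⊓ W ≤ W) _ h1
  rw [O.res_res] at this ⊢
  exact this

/-! ### The zero locus of an odd vector field -/

/-- The ideal of the zero locus `Z_Q`: the ideal generated by the components of `Q`, that is, by
the functions `Q g`. -/
def zeroIdeal {O : SuperPresheaf.{u, v} X} (Q : VectorField O 1) (U : Opens X) :
    Ideal (O.obj U) :=
  idealSheaf O (fun V => range (Q.app V)) U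

instance {O : SuperPresheaf.{u, v} X} (Q : VectorField O 1) (U : Opens X) :
    (zeroIdeal Q U).IsTwoSided := idealSheaf_isTwoSided O _ U

/-- The zero locus `Z_Q` with its functions: the functions on `Z_Q ∩ U` are the functions on `U`
modulo those that vanish on `Z_Q`. -/
def zeroLocus {O : SuperPresheaf.{u, v} X} (Q : VectorField O 1) : SuperPresheaf.{u, v} X where
  obj U := O.obj U ⧸ zeroIdeal Q U
  grading U i := (O.grading U i).map (Ideal.Quotient.mkₐ ℝ (zeroIdeal Q U)).toLinearMap
  res {U V} h := Ideal.quotientMapₐ (zeroIdeal Q V) (O.res h)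
    (fun f hf => res_mem_idealSheaf O _ h f hf)
  res_id U f := by
    obtain ⟨f, rfl⟩ := Ideal.Quotient.mk_surjective f
    exact congrArg (Ideal.Quotient.mk _) (O.res_id U f)
  res_res {U V W} h k f := by
    obtain ⟨f, rfl⟩ := Ideal.Quotient.mk_surjective f
    exact congrArg (Ideal.Quotient.mk _) (O.res_res h k f)
  res_mem {U V} h i f hf := by
    obtain ⟨g, hg, rfl⟩ := hf
    exact ⟨O.res h g, O.res_mem h i g hg, rfl⟩

/-- The restriction to `Z_Q` of a function. -/
def toZero {O : SuperPresheaf.{u, v} X} (Q : VectorField O 1) (U : Opens X) :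
    O.obj U →ₐ[ℝ] (zeroLocus Q).obj U :=
  Ideal.Quotient.mkₐ ℝ (zeroIdeal Q U)

/-- A function vanishes at the point `x` of the underlying space: its germ at `x` is not
invertible. -/
def VanishesAt (O : SuperPresheaf.{u, v} X) {U : Opens X} (f : O.obj U) (x : X) : Prop :=
  ∀ (V : Opens X) (h : V ≤ U), x ∈ V → ¬ IsUnit (O.res h f)

/-- The underlying set of points of the zero locus `Z_Q`. -/
def zeroPoints {O : SuperPresheaf.{u, v} X} (Q : VectorField O 1) : Set X :=
  {x | ∀ (U : Opens X) (f : O.obj U), x ∈ U → VanishesAt O (Q.app U f) x}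

/-- The zero locus `Z_Q` is a submanifold: near each of its points there are coordinates some of
which, set equal to zero, define `Z_Q`. -/
def IsZeroSubmanifold {O : SuperPresheaf.{u, v} X} (p q : ℕ) (Q : VectorField O 1) : Prop :=
  ∀ x ∈ zeroPoints Q, ∃ (c : SuperChart O p q) (A : Set (Fin p ⊕ Fin q)), x ∈ c.domain ∧
    ∀ V ≤ c.domain, zeroIdeal Q V =
      idealSheaf O (fun W => {g | ∃ h : W ≤ c.domain, ∃ a ∈ A, g = O.res h (c.coord a)}) V

/-- The local cohomology of `Q` at every point of the zero locus consists of constants only. -/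
def LocalCohomologyTrivial {O : SuperPresheaf.{u, v} X} (Q : VectorField O 1) : Prop :=
  ∀ x ∈ zeroPoints Q, ∀ (U : Opens X) (f : O.obj U), x ∈ U → Q.app U f = 0 →
    ∃ (V : Opens X) (h : V ≤ U) (r : ℝ) (g : O.obj V), x ∈ V ∧
      O.res h f = algebraMap ℝ (O.obj V) r + Q.app V g

/-- The bracket `{F, G} = (F, Q G)` on the zero locus `Z_Q`, computed on representatives; on a
QP-manifold it does not depend on them (`poissonBracket_toZero`). -/
def poissonBracket {O : SuperPresheaf.{u, v} X} (B : Antibracket O) (Q : VectorField O 1)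
    (U : Opens X) (a b : (zeroLocus Q).obj U) : (zeroLocus Q).obj U :=
  toZero Q U (B.app U (Quotient.out a) (Q.app U (Quotient.out b)))

/-- A vector field on `Z_Q` preserves the Poisson bracket. -/
def PreservesPoisson {O : SuperPresheaf.{u, v} X} (B : Antibracket O) (Q : VectorField O 1)
    {ε : ZMod 2} (y : VectorField (zeroLocus Q) ε) : Prop :=
  ∀ (U : Opens X) (i : ZMod 2) (a b : (zeroLocus Q).obj U), a ∈ (zeroLocus Q).grading U i →
    y.app U (poissonBracket B Q U a b) =
      poissonBracket B Q U (y.app U a) b + sgn (i * ε) • poissonBracket B Q U a (y.app U b)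

/-- The vector field `y` on `Z_Q` is the restriction of the vector field `Y`. -/
def IsRestriction {O : SuperPresheaf.{u, v} X} (Q : VectorField O 1) {ε : ZMod 2}
    (Y : VectorField O ε) (y : VectorField (zeroLocus Q) ε) : Prop :=
  ∀ (U : Opens X) (f : O.obj U), y.app U (toZero Q U f) = toZero Q U (Y.app U f)

/-- A classical gauge symmetry: a vector field that annihilates the master action `S` and
preserves the antibracket. -/
def IsClassicalGaugeSymmetry {O : SuperPresheaf.{u, v} X} (B : Antibracket O) (S : O.obj ⊤)
    {ε : ZMod 2} (Y : VectorField O ε) : Prop :=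
  Y.app ⊤ S = 0 ∧ PreservesAntibracket B Y

/-- A symmetry of the QP-structure: a vector field that preserves the antibracket and `Q`. -/
def IsSymmetry {O : SuperPresheaf.{u, v} X} (B : Antibracket O) (Q : VectorField O 1)
    {ε : ZMod 2} (Y : VectorField O ε) : Prop :=
  PreservesAntibracket B Y ∧ CommutesWithOdd Q Y

end Presheaf

section Manifold

variable {X : Type u} [TopologicalSpace X] [T2Space X] [SecondCountableTopology X] {p q N : ℕ}

/-- `(M, B, Q)` is a QP-manifold. -/
structure IsQPManifold (M : Supermanifold.{u, v} X p q) (B : Antibracket M.toSuperPresheaf)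
    (Q : VectorField M.toSuperPresheaf 1) : Prop where
  nondegenerate : B.Nondegenerate p q
  preserves : PreservesAntibracket B Q
  nilpotent : ∀ (U : Opens X) (f : M.obj U), Q.app U (Q.app U f) = 0

/-- `(M, B, Q)` is a P-QP-manifold: `M` is `(N|N)`-dimensional, the zero locus of `Q` is a
submanifold, and the local cohomology of `Q` is trivial at each of its points. -/
structure IsPQPManifold (M : Supermanifold.{u, v} X N N) (B : Antibracket M.toSuperPresheaf)
    (Q : VectorField M.toSuperPresheaf 1) : Prop extends IsQPManifold M B Q where
  submanifold : IsZeroSubmanifold N N Q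
  localCohomology : LocalCohomologyTrivial Q

/-! ### The Poisson bracket does not depend on representatives -/

lemma exists_homogeneous (M : Supermanifold.{u, v} X p q) (U : Opens X) (f : M.obj U) :
    ∃ f₀ ∈ M.grading U 0, ∃ f₁ ∈ M.grading U 1, f = f₀ + f₁ := by
  have hf : f ∈ ⨆ i, M.grading U i := by
    rw [(M.isInternal U).submodule_iSup_eq_top]; trivial
  induction hf using Submodule.iSup_induction' with
  | mem i x hx =>
    fin_cases i
    · exact ⟨x, hx, 0, Submodule.zero_mem _, (add_zero x).symm⟩
    · exact ⟨0, Submodule.zero_mem _, x, hx, (zero_add x).symm⟩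
  | zero => exact ⟨0, Submodule.zero_mem _, 0, Submodule.zero_mem _, (add_zero 0).symm⟩
  | add x y _ _ hx hy =>
    obtain ⟨x₀, h₀, x₁, h₁, rfl⟩ := hx
    obtain ⟨y₀, k₀, y₁, k₁, rfl⟩ := hy
    exact ⟨_, Submodule.add_mem _ h₀ k₀, _, Submodule.add_mem _ h₁ k₁, by abel⟩

lemma homogeneous_induction (M : Supermanifold.{u, v} X p q) (U : Opens X) {P : M.obj U → Prop}
    (hom : ∀ i, ∀ f ∈ M.grading U i, P f) (add : ∀ f g, P f → P g → P (f + g)) (f : M.obj U) :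
    P f := by
  obtain ⟨f₀, h₀, f₁, h₁, rfl⟩ := exists_homogeneous M U f
  exact add _ _ (hom 0 _ h₀) (hom 1 _ h₁)

lemma real_smul_mem {A : Type*} [Ring A] [Algebra ℝ A] (I : Ideal A) (r : ℝ) {a : A}
    (ha : a ∈ I) : r • a ∈ I := by
  rw [Algebra.smul_def]; exact I.mul_mem_left _ ha

variable {M : Supermanifold.{u, v} X p q} {B : Antibracket M.toSuperPresheaf}
  {Q : VectorField M.toSuperPresheaf 1}

lemma sgn_mul_self (i : ZMod 2) : sgn i * sgn i = 1 := by
  unfold sgn; split_ifs <;> norm_num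

lemma apply_mem_genIdeal (V : Opens X) (g : M.obj V) :
    Q.app V g ∈ genIdeal M.toSuperPresheaf (fun W => range (Q.app W)) V :=
  Ideal.subset_span ⟨V, le_rfl, _, ⟨g, rfl⟩, 1, by rw [M.res_id, mul_one]⟩

lemma genIdeal_homogeneous (V : Opens X) (f : M.obj V)
    (hf : f ∈ genIdeal M.toSuperPresheaf (fun W => range (Q.app W)) V) :
    ∃ f₀ ∈ M.grading V 0, ∃ f₁ ∈ M.grading V 1, f = f₀ + f₁ ∧
      f₀ ∈ genIdeal M.toSuperPresheaf (fun W => range (Q.app W)) V ∧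
      f₁ ∈ genIdeal M.toSuperPresheaf (fun W => range (Q.app W)) V := by
  set I := genIdeal M.toSuperPresheaf (fun W => range (Q.app W)) V with hI
  have hg := M.gradedMonoid V
  let P : M.obj V → Prop := fun f => ∃ f₀ ∈ M.grading V 0, ∃ f₁ ∈ M.grading V 1, f = f₀ + f₁ ∧
      f₀ ∈ I ∧ f₁ ∈ I
  have Phom : ∀ i, ∀ f ∈ M.grading V i, f ∈ I → P f := by
    intro i f hf hfI
    fin_cases i
    · exact ⟨f, hf, 0, Submodule.zero_mem _, (add_zero f).symm, hfI, I.zero_mem⟩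
    · exact ⟨0, Submodule.zero_mem _, f, hf, (zero_add f).symm, I.zero_mem, hfI⟩
  have Padd : ∀ f g, P f → P g → P (f + g) := by
    rintro _ _ ⟨a₀, h₀, a₁, h₁, rfl, i₀, i₁⟩ ⟨b₀, k₀, b₁, k₁, rfl, j₀, j₁⟩
    exact ⟨_, Submodule.add_mem _ h₀ k₀, _, Submodule.add_mem _ h₁ k₁, by abel,
      I.add_mem i₀ j₀, I.add_mem i₁ j₁⟩
  change P f
  rw [hI] at hf
  unfold genIdeal at hf
  induction hf using Submodule.span_induction with
  | mem x hx =>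
    obtain ⟨W, h, _, ⟨k, rfl⟩, b, rfl⟩ := hx
    rw [← Q.app_res h]
    generalize M.res h k = k
    induction k using homogeneous_induction M V with
    | add k l hk hl => rw [map_add, add_mul]; exact Padd _ _ hk hl
    | hom i k hk =>
      induction b using homogeneous_induction M V with
      | add b c hb hc => rw [mul_add]; exact Padd _ _ hb hc
      | hom j b hb =>
        exact Phom _ _ (hg.mul_mem (Q.app_mem V i k hk) hb)
          (genIdeal_mul_right _ _ _ _ _ (apply_mem_genIdeal V k))
  | zero => exact Phom 0 _ (Submodule.zero_mem _) I.zero_mem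
  | add x y _ _ hx hy => exact Padd _ _ hx hy
  | smul a x _ hx =>
    obtain ⟨x₀, h₀, x₁, h₁, rfl, i₀, i₁⟩ := hx
    rw [smul_eq_mul]
    induction a using homogeneous_induction M V with
    | add a c ha hc => rw [add_mul]; exact Padd _ _ ha hc
    | hom i a ha =>
      rw [mul_add]
      exact Padd _ _ (Phom _ _ (hg.mul_mem ha h₀) (I.mul_mem_left a i₀))
        (Phom _ _ (hg.mul_mem ha h₁) (I.mul_mem_left a i₁))

lemma bracket_exact_genIdeal (hQ : IsQPManifold M B Q) (V : Opens X) (F f : M.obj V)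
    (hf : f ∈ genIdeal M.toSuperPresheaf (fun W => range (Q.app W)) V) :
    B.app V (Q.app V F) f ∈ genIdeal M.toSuperPresheaf (fun W => range (Q.app W)) V := by
  set I := genIdeal M.toSuperPresheaf (fun W => range (Q.app W)) V with hI
  induction F using homogeneous_induction M V with
  | add F G hF hG => rw [map_add, map_add, LinearMap.add_apply]; exact I.add_mem hF hG
  | hom n F hF =>
    have hQF := Q.app_mem V n F hF
    rw [hI] at hf
    unfold genIdeal at hf
    induction hf using Submodule.span_induction with
    | mem x hx =>
      obtain ⟨W, h, _, ⟨k, rfl⟩, b, rfl⟩ := hx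
      rw [← Q.app_res h]
      generalize M.res h k = k
      induction k using homogeneous_induction M V with
      | add k l hk hl => rw [map_add, add_mul, map_add]; exact I.add_mem hk hl
      | hom i k hk =>
        rw [B.leibniz V _ _ _ _ b hQF (Q.app_mem V i k hk)]
        refine I.add_mem (genIdeal_mul_right _ _ _ _ _ ?_)
          (real_smul_mem I _ (genIdeal_mul_right _ _ _ _ _ (apply_mem_genIdeal V k)))
        have h1 := hQ.preserves V _ (Q.app V F) k hQF
        rw [hQ.nilpotent V F, map_zero, LinearMap.zero_apply, zero_add] at h1
        have h2 := congrArg (fun z => sgn ((n + 1 + 1) * 1) • z) h1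
        simp only [smul_smul, sgn_mul_self, one_smul] at h2
        rw [← h2]
        exact real_smul_mem I _ (apply_mem_genIdeal V _)
    | zero => rw [map_zero]; exact I.zero_mem
    | add x y _ _ hx hy => rw [map_add]; exact I.add_mem hx hy
    | smul a x hx' hx =>
      rw [smul_eq_mul]
      induction a using homogeneous_induction M V with
      | add a c ha hc => rw [add_mul, map_add]; exact I.add_mem ha hc
      | hom i a ha =>
        rw [B.leibniz V _ _ _ _ x hQF ha]
        exact I.add_mem (I.mul_mem_left _ hx') (real_smul_mem I _ (I.mul_mem_left _ hx))

lemma bracket_left_genIdeal (hQ : IsQPManifold M B Q) (V : Opens X) (f G : M.obj V)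
    (hf : f ∈ genIdeal M.toSuperPresheaf (fun W => range (Q.app W)) V) :
    B.app V f (Q.app V G) ∈ genIdeal M.toSuperPresheaf (fun W => range (Q.app W)) V := by
  set I := genIdeal M.toSuperPresheaf (fun W => range (Q.app W)) V with hI
  obtain ⟨f₀, h₀, f₁, h₁, rfl, i₀, i₁⟩ := genIdeal_homogeneous V f hf
  induction G using homogeneous_induction M V with
  | add F G hF hG =>
    rw [map_add (Q.app V) F G, map_add (B.app V (f₀ + f₁))]
    exact I.add_mem hF hG
  | hom n G hG =>
    have hQG := Q.app_mem V n G hG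
    rw [map_add, LinearMap.add_apply, B.antisymm V _ _ _ _ h₀ hQG, B.antisymm V _ _ _ _ h₁ hQG]
    exact I.add_mem (I.neg_mem (real_smul_mem I _ (bracket_exact_genIdeal hQ V G _ i₀)))
      (I.neg_mem (real_smul_mem I _ (bracket_exact_genIdeal hQ V G _ i₁)))

lemma bracket_right_genIdeal (hQ : IsQPManifold M B Q) (V : Opens X) (F g : M.obj V)
    (hg : g ∈ genIdeal M.toSuperPresheaf (fun W => range (Q.app W)) V) :
    B.app V F (Q.app V g) ∈ genIdeal M.toSuperPresheaf (fun W => range (Q.app W)) V := by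
  set I := genIdeal M.toSuperPresheaf (fun W => range (Q.app W)) V with hI
  induction F using homogeneous_induction M V with
  | add F G hF hG => rw [map_add, LinearMap.add_apply]; exact I.add_mem hF hG
  | hom n F hF =>
    have h1 := hQ.preserves V n F g hF
    have h2 : B.app V F (Q.app V g) = sgn ((n + 1) * 1) •
        (Q.app V (B.app V F g) - B.app V (Q.app V F) g) := by
      rw [h1, add_sub_cancel_left, smul_smul, sgn_mul_self, one_smul]
    rw [h2]
    exact real_smul_mem I _ (I.sub_mem (apply_mem_genIdeal V _)
      (bracket_exact_genIdeal hQ V F g hg))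

/-- The Poisson bracket on the zero locus does not depend on the representatives. -/
theorem poissonBracket_toZero (hQ : IsQPManifold M B Q) (U : Opens X) (F G : M.obj U) :
    poissonBracket B Q U (toZero Q U F) (toZero Q U G) =
      toZero Q U (B.app U F (Q.app U G)) := by
  have out_sub : ∀ F : M.obj U, Quotient.out (toZero Q U F) - F ∈ zeroIdeal Q U := fun F =>
    Ideal.Quotient.eq.1 (Quotient.out_eq (toZero Q U F))
  unfold poissonBracket
  refine Ideal.Quotient.eq.2 ?_
  have hF := out_sub F
  have hG := out_sub G
  set F' : M.obj U := Quotient.out (toZero Q U F)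
  set G' : M.obj U := Quotient.out (toZero Q U G)
  have e : B.app U F' (Q.app U G') - B.app U F (Q.app U G) =
      B.app U (F' - F) (Q.app U G') + B.app U F (Q.app U (G' - G)) := by
    simp only [map_sub, LinearMap.sub_apply]
    abel
  rw [e]
  refine Ideal.add_mem _ ?_ ?_
  · intro x hx
    obtain ⟨V, h, hxV, h1⟩ := hF x hx
    refine ⟨V, h, hxV, ?_⟩
    rw [← B.app_res h, ← Q.app_res h]
    exact bracket_left_genIdeal hQ V _ _ h1
  · intro x hx
    obtain ⟨V, h, hxV, h1⟩ := hG x hx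
    refine ⟨V, h, hxV, ?_⟩
    rw [← B.app_res h, ← Q.app_res h]
    exact bracket_right_genIdeal hQ V _ _ h1

end Manifold

end BV

end

/-!
A vector field `Y` that preserves the antibracket and annihilates `S` commutes with `Q = (S, · )`:
put `F = S` in `Y (F, G) = (Y F, G) ± (F, Y G)` (`commutesWithOdd_hamiltonian`). The two parities
`S` even, `Q` odd turn the remaining sign into the one of the supercommutator.

Since `Y (Q g) = ± Q (Y g)`, the field `Y` maps the generators of the ideal of `Z_Q` to elements
of that ideal, hence, by the Leibniz rule, it maps the ideal into itself (`app_mem_zeroIdeal`) and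
induces a vector field on the quotient (`CommutesWithOdd.restrictZero`), the only one compatible
with `Y` because restriction of functions to `Z_Q` is surjective.

Finally `Y {F, G} = Y (F, Q G) = (Y F, Q G) ± (F, Y (Q G)) = (Y F, Q G) ± (F, Q (Y G))`. Moving `Y`
past `Q` costs the factor `(-1)^ε`, which turns the antibracket sign `(-1)^((i + 1) ε)` into the
Poisson sign `(-1)^(i ε)` (`preservesPoisson_of_isRestriction`). This computation takes place on
homogeneous representatives; that the bracket does not depend on them is `poissonBracket_toZero`.
-/

namespace BV

lemma sgn_add (i j : ZMod 2) : sgn (i + j) = sgn i * sgn j := by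
  have h : ∀ k : ZMod 2, k = 0 ∨ k = 1 := by decide
  have h11 : (1 + 1 : ZMod 2) = 0 := by decide
  rcases h i with rfl | rfl <;> rcases h j with rfl | rfl <;> simp [sgn, h11]

section Presheaf

variable {X : Type u} [TopologicalSpace X] {O : SuperPresheaf.{u, v} X}

lemma CommutesWithOdd.app_app {Q : VectorField O 1} {ε : ZMod 2} {Y : VectorField O ε}
    (h : CommutesWithOdd Q Y) (U : Opens X) (f : O.obj U) :
    Y.app U (Q.app U f) = sgn ε • Q.app U (Y.app U f) := by
  rw [sub_eq_zero.1 (h U f), smul_smul, sgn_mul_self, one_smul]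

lemma commutesWithOdd_hamiltonian {B : Antibracket O} {S : O.obj ⊤} (hS : S ∈ O.grading ⊤ 0)
    {ε : ZMod 2} {Y : VectorField O ε} (hY : IsClassicalGaugeSymmetry B S Y) :
    CommutesWithOdd (B.hamiltonian S hS) Y := by
  intro U f
  have h := hY.2 U 0 (O.res le_top S) f (O.res_mem le_top 0 S hS)
  rw [Y.app_res, hY.1, map_zero, map_zero, LinearMap.zero_apply, zero_add, zero_add, one_mul] at h
  change B.app U (O.res le_top S) (Y.app U f) - sgn ε • Y.app U (B.app U (O.res le_top S) f) = 0
  rw [h, smul_smul, sgn_mul_self, one_smul, sub_self]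

lemma toZero_surjective (Q : VectorField O 1) (U : Opens X) :
    Function.Surjective (toZero Q U) :=
  Ideal.Quotient.mk_surjective

lemma IsRestriction.unique {Q : VectorField O 1} {ε : ZMod 2} {Y : VectorField O ε}
    {y z : VectorField (zeroLocus Q) ε} (hy : IsRestriction Q Y y) (hz : IsRestriction Q Y z) :
    y = z := by
  ext U a
  obtain ⟨f, rfl⟩ := toZero_surjective Q U a
  rw [hy, hz]

end Presheaf

section Manifold

variable {X : Type u} [TopologicalSpace X] [T2Space X] [SecondCountableTopology X] {p q : ℕ}
  {M : Supermanifold.{u, v} X p q} {Q : VectorField M.toSuperPresheaf 1} {ε : ZMod 2}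
  {Y : VectorField M.toSuperPresheaf ε}

lemma app_mem_genIdeal (h : CommutesWithOdd Q Y) (V : Opens X) (f : M.obj V)
    (hf : f ∈ genIdeal M.toSuperPresheaf (fun W => range (Q.app W)) V) :
    Y.app V f ∈ genIdeal M.toSuperPresheaf (fun W => range (Q.app W)) V := by
  set I := genIdeal M.toSuperPresheaf (fun W => range (Q.app W)) V with hI
  rw [hI] at hf
  unfold genIdeal at hf
  induction hf using Submodule.span_induction with
  | mem x hx =>
    obtain ⟨W, hW, _, ⟨k, rfl⟩, b, rfl⟩ := hx
    rw [← Q.app_res hW]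
    generalize M.res hW k = k
    induction k using homogeneous_induction M V with
    | add k l hk hl => rw [map_add, add_mul, map_add]; exact I.add_mem hk hl
    | hom i k hk =>
      rw [Y.leibniz V _ _ b (Q.app_mem V i k hk), h.app_app]
      exact I.add_mem
        (genIdeal_mul_right _ _ _ _ _ (real_smul_mem I _ (apply_mem_genIdeal V _)))
        (real_smul_mem I _ (genIdeal_mul_right _ _ _ _ _ (apply_mem_genIdeal V k)))
  | zero => rw [map_zero]; exact I.zero_mem
  | add x y _ _ hx hy => rw [map_add]; exact I.add_mem hx hy
  | smul a x hxI hx =>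
    rw [smul_eq_mul]
    induction a using homogeneous_induction M V with
    | add a c ha hc => rw [add_mul, map_add]; exact I.add_mem ha hc
    | hom i a ha =>
      rw [Y.leibniz V i a x ha]
      exact I.add_mem (I.mul_mem_left _ hxI) (real_smul_mem I _ (I.mul_mem_left _ hx))

/-- A vector field that commutes with `Q` is tangent to the zero locus of `Q`. -/
lemma app_mem_zeroIdeal (h : CommutesWithOdd Q Y) (U : Opens X) (f : M.obj U)
    (hf : f ∈ zeroIdeal Q U) : Y.app U f ∈ zeroIdeal Q U := by
  intro x hx
  obtain ⟨V, hV, hxV, hfV⟩ := hf x hx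
  refine ⟨V, hV, hxV, ?_⟩
  rw [← Y.app_res hV]
  exact app_mem_genIdeal h V _ hfV

/-- The restriction to the zero locus of `Q` of a vector field that commutes with `Q`: the map
induced on functions modulo the ideal of the zero locus. -/
noncomputable def CommutesWithOdd.restrictZero (h : CommutesWithOdd Q Y) :
    VectorField (zeroLocus Q) ε where
  app U := ((zeroIdeal Q U).restrictScalars ℝ).mapQ ((zeroIdeal Q U).restrictScalars ℝ) (Y.app U)
    (fun f hf => app_mem_zeroIdeal h U f hf)
  app_res {U V} hV a := by
    obtain ⟨f, rfl⟩ := toZero_surjective Q U a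
    exact congrArg (toZero Q V) (Y.app_res hV f)
  app_mem U i a ha := by
    obtain ⟨f, hf, rfl⟩ := ha
    exact ⟨Y.app U f, Y.app_mem U i f hf, rfl⟩
  leibniz U i a b ha := by
    obtain ⟨f, hf, rfl⟩ := ha
    obtain ⟨g, rfl⟩ := toZero_surjective Q U b
    exact congrArg (toZero Q U) (Y.leibniz U i f g hf)

lemma isRestriction_restrictZero (h : CommutesWithOdd Q Y) : IsRestriction Q Y h.restrictZero :=
  fun _ _ => rfl

lemma preservesPoisson_of_isRestriction {B : Antibracket M.toSuperPresheaf}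
    (hQ : IsQPManifold M B Q) (hY : IsSymmetry B Q Y) {y : VectorField (zeroLocus Q) ε}
    (hy : IsRestriction Q Y y) : PreservesPoisson B Q y := by
  rintro U i _ b ⟨f, hf, rfl⟩
  obtain ⟨g, rfl⟩ := toZero_surjective Q U b
  change y.app U (poissonBracket B Q U (toZero Q U f) (toZero Q U g)) =
    poissonBracket B Q U (y.app U (toZero Q U f)) (toZero Q U g) +
      sgn (i * ε) • poissonBracket B Q U (toZero Q U f) (y.app U (toZero Q U g))
  have key : Y.app U (B.app U f (Q.app U g)) =
      B.app U (Y.app U f) (Q.app U g) + sgn (i * ε) • B.app U f (Q.app U (Y.app U g)) := by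
    rw [hY.1 U i f _ hf, hY.2.app_app, map_smul, smul_smul, add_mul, one_mul, sgn_add, mul_assoc,
      sgn_mul_self, mul_one]
  rw [hy, hy, poissonBracket_toZero hQ, poissonBracket_toZero hQ, poissonBracket_toZero hQ, hy, key,
    map_add, map_smul]

end Manifold

end BV

theorem mainTheorem6 {X : Type*} [TopologicalSpace X] [T2Space X] [SecondCountableTopology X]
    {N : ℕ} (M : BV.Supermanifold X N N) (B : BV.Antibracket M.toSuperPresheaf)
    (S : M.obj ⊤) (hS : S ∈ M.grading ⊤ 0) (hmaster : B.app ⊤ S S = 0)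
    (hM : BV.IsPQPManifold M B (B.hamiltonian S hS))
    (ε : ZMod 2) (X₀ : BV.VectorField M.toSuperPresheaf ε)
    (hX₀ : BV.IsClassicalGaugeSymmetry B S X₀) :
    BV.IsSymmetry B (B.hamiltonian S hS) X₀ ∧
      (∃! x : BV.VectorField (BV.zeroLocus (B.hamiltonian S hS)) ε,
        BV.IsRestriction (B.hamiltonian S hS) X₀ x) ∧
      ∀ x : BV.VectorField (BV.zeroLocus (B.hamiltonian S hS)) ε,
        BV.IsRestriction (B.hamiltonian S hS) X₀ x →
          BV.PreservesPoisson B (B.hamiltonian S hS) x := by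
  have hcomm := BV.commutesWithOdd_hamiltonian hS hX₀
  have hsymm : BV.IsSymmetry B (B.hamiltonian S hS) X₀ := ⟨hX₀.2, hcomm⟩
  have hrestr := BV.isRestriction_restrictZero hcomm
  exact ⟨hsymm, ⟨hcomm.restrictZero, hrestr, fun _ hx => hx.unique hrestr⟩,
    fun _ hx => BV.preservesPoisson_of_isRestriction hM.toIsQPManifold hsymm hx⟩
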